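/- For a finite simple graph $G=(V,E)$ on $V=\{1,\dots,p\}$ and $\lambda>0$, let $P_G(x)=\frac1Z\exp\big(\lambda\sum_{\{i,j\}\in E}x_ix_j\big)$, $x\in\{-1,1\}^p$, be the ferromagnetic Ising model on $G$ (each edge counted once, $Z$ the normalizing constant). An estimator maps $n$ independent samples from $P_G$ to a graph on $V$ with edge set $\hat E$. Let $\mathcal G_k$ be the class of all graphs on $V$ with at most $k$ edges, and let $$P_{\mathrm e}(q_{\max})=\max_{G\in\mathcal G_k}\mathbb P_G\big[|E\,\triangle\,\hat E|>q_{\max}\big].$$ Write $H_2(\theta)=-\theta\log\theta-(1-\theta)\log(1-\theta)$, with natural logarithms. Theorem. Let $c>0$, $\nu\in[0,1)$ and $\theta\in(0,\frac14)$ be constants, and for each $p$ let $k=\lfloor c\,p^{1+\nu}\rfloor$ and $q_{\max}=\lfloor\theta k\rfloor$. Then, as $p\to\infty$, it is necessary that $$n\ \ge\ \max\left\{\frac{e^{\lambda(\sqrt{k/2}-2)/2}\,\big(\log 2-H_2(2\theta)\big)}{6\lambda k},\ \frac{\log 2-H_2(\theta)}{\lambda\,\dfrac{e^{2\lambda}\cosh(4\lambda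 c p^{\nu})-1}{e^{2\lambda}\cosh(4\lambda c p^{\nu})+1}}\right\}\big(1-\delta-o(1)\big)$$ in order for some estimator to achieve $P_{\mathrm e}(q_{\max})\le\delta$. Here $\lambda>0$, $n$, $\delta$ and the estimator are arbitrary and may vary with $p$, the estimator may depend on $\lambda$, and the $o(1)$ term is a sequence indexed by $p$ that tends to $0$ and depends only on $c,\nu,\theta$. -/

import Mathlib

open Real Filter Topology

noncomputable section

/-- A configuration of `p` spins; each spin lies in `ℤˣ = {1, -1}`. -/
abbrev SpinConfig (p : ℕ) : Type := Fin p → ℤˣ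

/-- The numerical value `±1` of the spin at node `i`. -/
def spin {p : ℕ} (x : SpinConfig p) (i : Fin p) : ℝ := ((x i : ℤ) : ℝ)

open Classical in
/-- The exponent `∑_{(i,j) ∈ E} lam * x_i * x_j` of the Ising model on `G` with all edge weights
equal to `lam`; every (undirected) edge is counted exactly once. -/
def isingExponent {p : ℕ} (G : SimpleGraph (Fin p)) (lam : ℝ) (x : SpinConfig p) : ℝ :=
  ∑ i, ∑ j, if i < j ∧ G.Adj i j then lam * spin x i * spin x j else 0

/-- The partition function `Z`. -/
def isingPartition {p : ℕ} (G : SimpleGraph (Fin p)) (lam : ℝ) : ℝ :=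
  ∑ x : SpinConfig p, exp (isingExponent G lam x)

/-- The Ising probability mass function `P_G`. -/
def isingProb {p : ℕ} (G : SimpleGraph (Fin p)) (lam : ℝ) (x : SpinConfig p) : ℝ :=
  exp (isingExponent G lam x) / isingPartition G lam

/-- `n` samples of the `p` spins: row `t` is the `t`-th sample. -/
abbrev Samples (n p : ℕ) : Type := Fin n → SpinConfig p

/-- The joint probability mass function of `n` independent samples from `P_G`. -/
def sampleProb {p : ℕ} (G : SimpleGraph (Fin p)) (lam : ℝ) {n : ℕ} (X : Samples n p) : ℝ :=
  ∏ t, isingProb G lam (X t)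

/-- An estimator (decoder) maps the samples to a graph on the same nodes. -/
abbrev Estimator (n p : ℕ) : Type := Samples n p → SimpleGraph (Fin p)

/-- The edit distance `|E Δ E'|` between two graphs. -/
def editDist {p : ℕ} (G G' : SimpleGraph (Fin p)) : ℕ :=
  (symmDiff G.edgeSet G'.edgeSet).ncard

open Classical in
/-- `P_G[|E Δ Ê| > q]` for the estimator `est` applied to `n` independent samples from `P_G`. -/
def errorProb {n p : ℕ} (est : Estimator n p) (lam : ℝ) (q : ℕ) (G : SimpleGraph (Fin p)) : ℝ :=
  ∑ X : Samples n p, if q < editDist G (est X) then sampleProb G lam X else 0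

/-- The edge bounded class: all graphs on `p` nodes with at most `k` edges. -/
def edgeBoundedClass (p k : ℕ) : Set (SimpleGraph (Fin p)) :=
  {G | G.edgeSet.ncard ≤ k}

/-- The worst-case error probability `max_{G ∈ 𝒢} P_G[|E Δ Ê| > q]` over a class `𝒢` of graphs
(a maximum over a finite set, as there are finitely many graphs on `p` nodes). -/
def worstCaseError {n p : ℕ} (est : Estimator n p) (lam : ℝ) (q : ℕ)
    (𝒢 : Set (SimpleGraph (Fin p))) : ℝ :=
  ⨆ G : 𝒢, errorProb est lam q G.1

/-- The edge bound `k = ⌊c p^{1+ν}⌋`. -/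
def edgeBound (c ν : ℝ) (p : ℕ) : ℕ := ⌊c * (p : ℝ) ^ (1 + ν)⌋₊

/-- The distortion level `q_max = ⌊θ k⌋`. -/
def distortionLevel (θ : ℝ) (k : ℕ) : ℕ := ⌊θ * (k : ℝ)⌋₊

end

/-!
The bound comes from Fano's inequality for approximate recovery, applied to two ensembles of graphs
with at most `k` edges. Each ensemble consists of all graphs that contain a fixed base graph `B` and
any subset of a set `F` of `N` free edges. An estimate is within distance `θ k` of at most
`exp (N H(θ k / N))` of these `2 ^ N` graphs, so an estimator that succeeds with probability `1 - δ`
has to extract about `(1 - δ) N (log 2 - H(θ k / N))` nats from the samples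
(`fano_of_kl_le`, `card_powerset_filter_card_le`).

One sample supplies at most the Kullback-Leibler divergence of the Ising model on `B ∪ T`, `T ⊆ F`,
from the one on `B`. Bounding it by the symmetrized divergence removes the partition functions and
leaves `lam` times the sum over `T` of the increase in the edge correlations (`kl_isingProb_le`).
So `n` is at least about `(1 - δ) (log 2 - H(θ k / N)) / (lam κ)`, where `κ` bounds that increase on
a single edge (`sampleSize_lower_bound`).

* For the first term of the maximum, `B` is the complete bipartite graph with two sides of
  `a = ⌊√(k / 2)⌋` nodes and `F` consists of the `a (a - 1) ~ k / 2` pairs inside the sides.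
  Already under `B` two spins of a side are almost always equal: configurations in which the other
  side is weakly magnetized have a small total weight, and under a strong magnetization a
  disagreeing spin is exponentially unlikely. Thus `κ = 8 exp (-lam a / 2)`
  (`one_sub_correlation_le`).
* For the second term, `B` is empty and `F` is a nearly regular graph with `N ~ k` edges and degrees
  at most `m + 1`, where `m = ⌊2 c p ^ ν⌋`. Flipping the two endpoints of an edge shows that its
  correlation is at most `(R - 1) / (R + 1)` with `R = exp (2 lam) cosh (2 lam m)`
  (`correlation_le`).
-/

noncomputable section

open Finset

/-! ### Fano's inequality and divergences on finite sets -/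

/-- Fano's inequality for approximate recovery. A message `i` is uniform on `I`, the observation has
law `P i`, and each observation is a `good` outcome for at most a fraction `exp (-L)` of the
messages. If every message is recovered with probability at least `1 - δ` and every `P i` has
Kullback-Leibler divergence at most `K` from one reference law `Q`, then `(1 - δ) L - log 2 ≤ K`. -/
theorem fano_of_kl_le {ι Ω : Type*} [Fintype Ω] (I : Finset ι) (hI : I.Nonempty)
    (P : ι → Ω → ℝ) (Q : Ω → ℝ) (good : ι → Ω → Prop) [∀ i ω, Decidable (good i ω)]
    (hP : ∀ i ∈ I, ∀ ω, 0 < P i ω) (hP1 : ∀ i ∈ I, ∑ ω, P i ω = 1)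
    (hQ : ∀ ω, 0 < Q ω) (hQ1 : ∑ ω, Q ω = 1) {K L δ : ℝ} (hL : 0 ≤ L)
    (hK : ∀ i ∈ I, ∑ ω, P i ω * log (P i ω / Q ω) ≤ K)
    (hcount : ∀ ω, (#{i ∈ I | good i ω} : ℝ) ≤ #I * exp (-L))
    (hgood : ∀ i ∈ I, 1 - δ ≤ ∑ ω, if good i ω then P i ω else 0) :
    (1 - δ) * L - log 2 ≤ K := by
  have hM : (0 : ℝ) < #I := by exact_mod_cast hI.card_pos
  have key : ∀ i ∈ I, (1 - δ) * L ≤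
      K + (1 + (exp L - 1) * ∑ ω, if good i ω then Q ω else 0) / 2 - 1 + log 2 := by
    intro i hi
    have hpt : ∀ ω, (if good i ω then P i ω else 0) * L ≤ P i ω * log (P i ω / Q ω)
        + (Q ω + (exp L - 1) * (if good i ω then Q ω else 0)) / 2 - P i ω + P i ω * log 2 := by
      intro ω
      have hp := hP i hi ω
      have hq := hQ ω
      -- The Donsker-Varadhan bound for the test function `f`, linearized by `log t ≤ t - 1` at the
      -- value `2`, which bounds the average over `I` of the exponential moment under `Q`.
      have gen : ∀ f : ℝ, P i ω * f ≤ P i ω * log (P i ω / Q ω) + Q ω * exp f / 2 - P i ω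
          + P i ω * log 2 := by
        intro f
        have h := log_le_sub_one_of_pos (x := Q ω * exp f / (2 * P i ω)) (by positivity)
        rw [log_div (by positivity) (by positivity), log_mul (by positivity) (by positivity),
          log_exp, log_mul (by positivity) (by positivity)] at h
        rw [log_div (by positivity) (by positivity)]
        have h2 := mul_le_mul_of_nonneg_left h hp.le
        have h3 : P i ω * (Q ω * exp f / (2 * P i ω) - 1) = Q ω * exp f / 2 - P i ω := by
          field_simp
        rw [h3] at h2
        linarith
      by_cases hg : good i ω
      · have := gen L
        simp only [hg, if_true]
        linarith
      · have := gen 0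
        simp only [hg, if_false]
        simp only [exp_zero] at this
        linarith
    have hs := Finset.sum_le_sum fun ω (_ : ω ∈ univ) => hpt ω
    simp only [← sum_mul, sum_add_distrib, sum_sub_distrib, ← sum_div, ← mul_sum, hP1 i hi,
      hQ1] at hs
    have h1 := mul_le_mul_of_nonneg_right (hgood i hi) hL
    have h2 := hK i hi
    linarith
  have hsum := Finset.sum_le_sum key
  have hswap : ∑ i ∈ I, ∑ ω, (if good i ω then Q ω else 0) ≤ #I * exp (-L) := by
    rw [sum_comm]
    calc ∑ ω, ∑ i ∈ I, (if good i ω then Q ω else 0)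
        = ∑ ω, (#{i ∈ I | good i ω} : ℝ) * Q ω := by
          refine sum_congr rfl fun ω _ => ?_
          rw [← sum_filter, sum_const, nsmul_eq_mul]
      _ ≤ ∑ ω, #I * exp (-L) * Q ω :=
          sum_le_sum fun ω _ => mul_le_mul_of_nonneg_right (hcount ω) (hQ ω).le
      _ = _ := by rw [← mul_sum, hQ1, mul_one]
  simp only [sum_add_distrib, sum_sub_distrib, ← sum_div, ← mul_sum, sum_const,
    nsmul_eq_mul, mul_one] at hsum
  have h1 : 0 ≤ exp L - 1 := by linarith [one_le_exp hL]
  have h2 := mul_le_mul_of_nonneg_left hswap h1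
  have h3 : (exp L - 1) * (#I * exp (-L)) ≤ #I := by
    have : exp L * exp (-L) = 1 := by rw [← exp_add]; simp
    nlinarith [exp_pos (-L)]
  have h4 : (#I : ℝ) * ((1 - δ) * L) ≤ #I * (K + log 2) := by linarith
  have := le_of_mul_le_mul_left h4 hM
  linarith

theorem sum_prod_mul_apply {ι Ω : Type*} [Fintype ι] [DecidableEq ι] [Fintype Ω] (P g : Ω → ℝ)
    (hP : ∑ ω, P ω = 1) (t₀ : ι) :
    ∑ X : ι → Ω, (∏ t, P (X t)) * g (X t₀) = ∑ ω, P ω * g ω := by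
  have h : ∀ X : ι → Ω, (∏ t, P (X t)) * g (X t₀)
      = ∏ t, P (X t) * (if t = t₀ then g (X t) else 1) := by
    intro X
    rw [prod_mul_distrib, prod_ite_eq' univ t₀ fun t => g (X t), if_pos (mem_univ _)]
  simp_rw [h]
  rw [← Fintype.prod_sum fun t ω => P ω * (if t = t₀ then g ω else 1),
    prod_eq_single t₀]
  · simp
  · intro t _ ht
    simp [ht, hP]
  · simp

theorem sum_prod_eq_one {ι Ω : Type*} [Fintype ι] [DecidableEq ι] [Fintype Ω] (P : Ω → ℝ)
    (hP : ∑ ω, P ω = 1) : ∑ X : ι → Ω, ∏ t, P (X t) = 1 := by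
  rw [← Fintype.prod_sum fun _ ω => P ω]
  simp [hP]

/-- The Kullback-Leibler divergence is additive over independent samples. -/
theorem kl_pi_eq {n : ℕ} {Ω : Type*} [Fintype Ω] (P Q : Ω → ℝ) (hP : ∀ ω, 0 < P ω)
    (hQ : ∀ ω, 0 < Q ω) (hP1 : ∑ ω, P ω = 1) :
    ∑ X : Fin n → Ω, (∏ t, P (X t)) * log ((∏ t, P (X t)) / ∏ t, Q (X t))
      = n * ∑ ω, P ω * log (P ω / Q ω) := by
  have h : ∀ X : Fin n → Ω, (∏ t, P (X t)) * log ((∏ t, P (X t)) / ∏ t, Q (X t))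
      = ∑ t, (∏ t, P (X t)) * log (P (X t) / Q (X t)) := by
    intro X
    rw [← prod_div_distrib, log_prod fun t _ => (div_pos (hP _) (hQ _)).ne', mul_sum]
  simp_rw [h]
  rw [sum_comm, sum_congr rfl fun t _ =>
    sum_prod_mul_apply P (fun ω => log (P ω / Q ω)) hP1 t]
  simp

/-- The Kullback-Leibler divergence is at most its symmetrization, because the reversed divergence
is nonnegative. When `log (P / Q)` is `f` up to a constant, as for two Gibbs measures, the
normalizing constants drop out of the symmetrized divergence, which is the difference of the
expectations of `f`. -/
theorem kl_le_sum_sub_mul {Ω : Type*} [Fintype Ω] (P Q : Ω → ℝ) (hP : ∀ ω, 0 < P ω)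
    (hQ : ∀ ω, 0 < Q ω) (hP1 : ∑ ω, P ω = 1) (hQ1 : ∑ ω, Q ω = 1) (f : Ω → ℝ) (C : ℝ)
    (hf : ∀ ω, log (P ω / Q ω) = f ω + C) :
    ∑ ω, P ω * log (P ω / Q ω) ≤ ∑ ω, P ω * f ω - ∑ ω, Q ω * f ω := by
  have h1 : ∑ ω, Q ω * log (P ω / Q ω) ≤ 0 := by
    calc ∑ ω, Q ω * log (P ω / Q ω) ≤ ∑ ω, (P ω - Q ω) := by
          refine sum_le_sum fun ω _ => ?_
          have h := mul_le_mul_of_nonneg_left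
            (log_le_sub_one_of_pos (div_pos (hP ω) (hQ ω))) (hQ ω).le
          have h2 : Q ω * (P ω / Q ω - 1) = P ω - Q ω := by
            have := (hQ ω).ne'
            field_simp
          linarith
      _ = 0 := by rw [sum_sub_distrib, hP1, hQ1, sub_self]
  simp_rw [hf, mul_add, sum_add_distrib, ← sum_mul, hP1, hQ1] at h1 ⊢
  linarith

/-- The volume bound for a Hamming ball of radius at most `α |F|` with `α ≤ 1 / 2`: in the
expansion of `1 = (α + (1 - α)) ^ |F|`, each set of the ball contributes at least
`exp (-|F| H(α))`. -/
theorem card_powerset_filter_card_le {β : Type*} (F : Finset β) (q : ℕ) {α : ℝ} (h0 : 0 < α)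
    (h1 : α ≤ 1 / 2) (hq : (q : ℝ) ≤ α * #F) :
    (#{U ∈ F.powerset | #U ≤ q} : ℝ) ≤ exp (#F * binEntropy α) := by
  have hβ : 0 < 1 - α := by linarith
  have hterm : ∀ U ∈ F.powerset.filter (fun U => #U ≤ q),
      exp (-(#F * binEntropy α)) ≤ α ^ #U * (1 - α) ^ (#F - #U) := by
    intro U hU
    rw [mem_filter, mem_powerset] at hU
    have hle := card_le_card hU.1
    have hUq : (#U : ℝ) ≤ α * #F := le_trans (by exact_mod_cast hU.2) hq
    have e : α ^ #U * (1 - α) ^ (#F - #U)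
        = exp (#U * log α + (#F - #U : ℝ) * log (1 - α)) := by
      rw [exp_add, ← Nat.cast_sub hle, ← log_pow, ← log_pow, exp_log (by positivity),
        exp_log (by positivity)]
    rw [e, exp_le_exp, binEntropy, log_inv, log_inv]
    have hlog : log α ≤ log (1 - α) := log_le_log h0 (by linarith)
    nlinarith [mul_nonneg (sub_nonneg.2 hUq) (sub_nonneg.2 hlog)]
  have hsum := sum_le_sum hterm
  rw [sum_const, nsmul_eq_mul] at hsum
  have htot : ∑ U ∈ F.powerset.filter (fun U => #U ≤ q), α ^ #U * (1 - α) ^ (#F - #U) ≤ 1 := by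
    calc _ ≤ ∑ U ∈ F.powerset, α ^ #U * (1 - α) ^ (#F - #U) :=
          sum_le_sum_of_subset_of_nonneg (filter_subset _ _) fun _ _ _ => by positivity
      _ = 1 := by rw [sum_pow_mul_eq_add_pow]; simp
  rw [exp_neg, ← div_eq_mul_inv] at hsum
  have := (div_le_iff₀ (exp_pos _)).1 (hsum.trans htot)
  linarith

/-! ### Graphs as sets of ordered pairs, and the Ising model -/

open Classical in
/-- The edges of `G`, each written as the ordered pair `(i, j)` with `i < j`. -/
def edgePairs {p : ℕ} (G : SimpleGraph (Fin p)) : Finset (Fin p × Fin p) :=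
  {e | e.1 < e.2 ∧ G.Adj e.1 e.2}

/-- The graph whose edges are the pairs in `E`. -/
def graphOfPairs {p : ℕ} (E : Finset (Fin p × Fin p)) : SimpleGraph (Fin p) :=
  SimpleGraph.fromRel fun i j => (i, j) ∈ E

theorem mem_edgePairs {p : ℕ} {G : SimpleGraph (Fin p)} {e : Fin p × Fin p} :
    e ∈ edgePairs G ↔ e.1 < e.2 ∧ G.Adj e.1 e.2 := by
  simp [edgePairs]

theorem edgePairs_graphOfPairs {p : ℕ} {E : Finset (Fin p × Fin p)}
    (hE : ∀ e ∈ E, e.1 < e.2) : edgePairs (graphOfPairs E) = E := by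
  ext ⟨i, j⟩
  rw [mem_edgePairs, graphOfPairs, SimpleGraph.fromRel_adj]
  refine ⟨fun ⟨h, _, h'⟩ => h'.resolve_right fun h2 => absurd (hE _ h2) h.le.not_gt, fun h =>
    ⟨hE _ h, (hE _ h).ne, Or.inl h⟩⟩

theorem edgeSet_eq_image_edgePairs {p : ℕ} (G : SimpleGraph (Fin p)) :
    G.edgeSet = (fun e : Fin p × Fin p => s(e.1, e.2)) '' (edgePairs G : Set _) := by
  ext e
  induction e with
  | _ i j =>
    simp only [SimpleGraph.mem_edgeSet, Set.mem_image, mem_coe, mem_edgePairs, Prod.exists]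
    constructor
    · intro h
      rcases lt_or_gt_of_ne h.ne with h1 | h1
      · exact ⟨i, j, ⟨h1, h⟩, rfl⟩
      · exact ⟨j, i, ⟨h1, h.symm⟩, Sym2.eq_swap⟩
    · rintro ⟨a, b, ⟨_, h⟩, h2⟩
      rwa [← SimpleGraph.mem_edgeSet, ← h2]

theorem injOn_sym2_mk {p : ℕ} :
    Set.InjOn (fun e : Fin p × Fin p => s(e.1, e.2)) {e | e.1 < e.2} := by
  rintro ⟨a, b⟩ h ⟨c, d⟩ h' he
  simp only [Set.mem_ofPred_eq] at h h'
  rcases Sym2.eq_iff.1 he with ⟨rfl, rfl⟩ | ⟨rfl, rfl⟩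
  · rfl
  · exact absurd h h'.le.not_gt

theorem coe_edgePairs_subset {p : ℕ} (G : SimpleGraph (Fin p)) :
    (edgePairs G : Set (Fin p × Fin p)) ⊆ {e | e.1 < e.2} :=
  fun _ he => (mem_edgePairs.1 (mem_coe.1 he)).1

theorem ncard_edgeSet_eq {p : ℕ} (G : SimpleGraph (Fin p)) :
    G.edgeSet.ncard = #(edgePairs G) := by
  rw [edgeSet_eq_image_edgePairs, (injOn_sym2_mk.mono (coe_edgePairs_subset G)).ncard_image,
    Set.ncard_coe_finset]

theorem editDist_eq {p : ℕ} (G H : SimpleGraph (Fin p)) :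
    editDist G H = #(symmDiff (edgePairs G) (edgePairs H)) := by
  have key : ∀ G H : SimpleGraph (Fin p), G.edgeSet \ H.edgeSet =
      (fun e : Fin p × Fin p => s(e.1, e.2)) '' (edgePairs G \ edgePairs H : Set _) := by
    intro G H
    rw [edgeSet_eq_image_edgePairs, edgeSet_eq_image_edgePairs]
    ext e
    constructor
    · rintro ⟨⟨a, ha, rfl⟩, h⟩
      exact ⟨a, ⟨ha, fun hb => h ⟨a, hb, rfl⟩⟩, rfl⟩
    · rintro ⟨a, ⟨ha, hn⟩, rfl⟩
      refine ⟨⟨a, ha, rfl⟩, fun ⟨b, hb, he⟩ => hn ?_⟩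
      rwa [← injOn_sym2_mk (coe_edgePairs_subset H hb) (coe_edgePairs_subset G ha) he]
  rw [editDist, Set.symmDiff_def, key, key, ← Set.image_union, ← Set.symmDiff_def,
    ← coe_symmDiff, (injOn_sym2_mk.mono ?_).ncard_image, Set.ncard_coe_finset]
  intro e he
  rcases mem_symmDiff.1 (mem_coe.1 he) with h | h
  · exact coe_edgePairs_subset G h.1
  · exact coe_edgePairs_subset H h.1

theorem isingExponent_eq {p : ℕ} (G : SimpleGraph (Fin p)) (lam : ℝ) (x : SpinConfig p) :
    isingExponent G lam x = lam * ∑ e ∈ edgePairs G, spin x e.1 * spin x e.2 := by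
  classical
  rw [isingExponent, mul_sum, edgePairs, sum_filter, Fintype.sum_prod_type]
  simp only [mul_assoc]

theorem isingPartition_pos {p : ℕ} (G : SimpleGraph (Fin p)) (lam : ℝ) :
    0 < isingPartition G lam :=
  sum_pos (fun _ _ => exp_pos _) univ_nonempty

theorem isingProb_pos {p : ℕ} (G : SimpleGraph (Fin p)) (lam : ℝ) (x : SpinConfig p) :
    0 < isingProb G lam x := div_pos (exp_pos _) (isingPartition_pos G lam)

theorem sum_isingProb {p : ℕ} (G : SimpleGraph (Fin p)) (lam : ℝ) :
    ∑ x, isingProb G lam x = 1 := by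
  simp only [isingProb, ← sum_div]
  exact div_self (isingPartition_pos G lam).ne'

/-- The expectation of `x_i x_j` under the Ising model on `G`, for `e = (i, j)`. -/
def correlation {p : ℕ} (G : SimpleGraph (Fin p)) (lam : ℝ) (e : Fin p × Fin p) : ℝ :=
  ∑ x, isingProb G lam x * (spin x e.1 * spin x e.2)

/-- Adding the edges `T` to the graph `B` moves the Ising model by a divergence of at most `lam`
times the total increase of the correlations along `T`. -/
theorem kl_isingProb_le {p : ℕ} (B T : Finset (Fin p × Fin p)) (hdisj : Disjoint B T)
    (hlt : ∀ e ∈ B ∪ T, e.1 < e.2) (lam : ℝ) :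
    ∑ x, isingProb (graphOfPairs (B ∪ T)) lam x * log (isingProb (graphOfPairs (B ∪ T)) lam x /
        isingProb (graphOfPairs B) lam x) ≤
      lam * ∑ e ∈ T, (correlation (graphOfPairs (B ∪ T)) lam e -
        correlation (graphOfPairs B) lam e) := by
  have hB : ∀ e ∈ B, e.1 < e.2 := fun e he => hlt e (mem_union_left _ he)
  refine (kl_le_sum_sub_mul _ _ (isingProb_pos _ lam) (isingProb_pos _ lam)
    (sum_isingProb _ lam) (sum_isingProb _ lam)
    (fun x => lam * ∑ e ∈ T, spin x e.1 * spin x e.2)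
    (log (isingPartition (graphOfPairs B) lam) -
      log (isingPartition (graphOfPairs (B ∪ T)) lam)) ?_).trans_eq ?_
  · intro x
    have h1 := (isingPartition_pos (graphOfPairs B) lam).ne'
    have h2 := (isingPartition_pos (graphOfPairs (B ∪ T)) lam).ne'
    rw [log_div (isingProb_pos _ _ _).ne' (isingProb_pos _ _ _).ne', isingProb, isingProb,
      log_div (exp_pos _).ne' h2, log_div (exp_pos _).ne' h1, log_exp, log_exp,
      isingExponent_eq, isingExponent_eq, edgePairs_graphOfPairs hlt, edgePairs_graphOfPairs hB,
      sum_union hdisj]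
    ring
  · have h : ∀ G : SimpleGraph (Fin p), ∑ x, isingProb G lam x *
        (lam * ∑ e ∈ T, spin x e.1 * spin x e.2) = lam * ∑ e ∈ T, correlation G lam e := by
      intro G
      simp only [correlation]
      rw [sum_comm, mul_sum]
      refine sum_congr rfl fun x _ => ?_
      rw [← mul_sum]
      ring
    rw [h, h, sum_sub_distrib, mul_sub]

/-! ### Ensembles of graphs -/

/-- Among the sets between `B` and `B ∪ F`, at most a Hamming ball of `F` lies within distance `q` of
a given set `H`, which may contain elements outside `B ∪ F`. -/
theorem card_close_le {β : Type*} [DecidableEq β] (B F H : Finset β) (hdisj : Disjoint B F)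
    (q : ℕ) :
    #{T ∈ F.powerset | #(symmDiff (B ∪ T) H) ≤ q} ≤ #{U ∈ F.powerset | #U ≤ q} := by
  refine card_le_card_of_injOn (fun T => symmDiff T (H ∩ F)) ?_ ?_
  · intro T hT
    simp only [coe_filter, mem_powerset, Set.mem_ofPred_eq] at hT ⊢
    refine ⟨?_, (card_le_card ?_).trans hT.2⟩
    · intro e he
      rcases mem_symmDiff.1 he with h | h
      · exact hT.1 h.1
      · exact (mem_inter.1 h.1).2
    · intro e he
      rcases mem_symmDiff.1 he with h | h
      · refine mem_symmDiff.2 (Or.inl ⟨mem_union_right _ h.1, fun hH => h.2 ?_⟩)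
        exact mem_inter.2 ⟨hH, hT.1 h.1⟩
      · have hF := (mem_inter.1 h.1)
        refine mem_symmDiff.2 (Or.inr ⟨hF.1, fun hB => ?_⟩)
        rcases mem_union.1 hB with hB | hB
        · exact disjoint_left.1 hdisj hB hF.2
        · exact h.2 hB
  · intro T _ T' _ h
    exact symmDiff_left_injective _ h

theorem worstCaseError_ge {n p : ℕ} (est : Estimator n p) (lam : ℝ) (q : ℕ)
    (𝒢 : Set (SimpleGraph (Fin p))) {G : SimpleGraph (Fin p)} (hG : G ∈ 𝒢) :
    errorProb est lam q G ≤ worstCaseError est lam q 𝒢 :=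
  le_ciSup (f := fun G : 𝒢 => errorProb est lam q G.1) (Set.finite_range _).bddAbove ⟨G, hG⟩

theorem errorProb_nonneg {n p : ℕ} (est : Estimator n p) (lam : ℝ) (q : ℕ)
    (G : SimpleGraph (Fin p)) : 0 ≤ errorProb est lam q G := by
  refine sum_nonneg fun X _ => ?_
  split_ifs
  · exact prod_nonneg fun t _ => (isingProb_pos _ _ _).le
  · exact le_rfl

/-- The lower bound on the number of samples produced by an ensemble of graphs: all graphs
containing the edges `B` and an arbitrary part of the edges `F`, when along each free edge the
correlation exceeds its value in the base graph `B` by at most `κ`. The law of the samples from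
the base graph serves as the reference law in Fano's inequality. -/
theorem sampleSize_lower_bound {p k q n : ℕ} (est : Estimator n p)
    (B F : Finset (Fin p × Fin p)) (hdisj : Disjoint B F) (hlt : ∀ e ∈ B ∪ F, e.1 < e.2)
    (hcard : #B + #F ≤ k) (hF : 0 < #F) {lam δ α κ : ℝ}
    (hlam : 0 ≤ lam)
    (herr : worstCaseError est lam q (edgeBoundedClass p k) ≤ δ)
    (h0 : 0 < α) (h1 : α ≤ 1 / 2) (hq : (q : ℝ) ≤ α * #F)
    (hκ : ∀ T ⊆ F, ∀ e ∈ T, correlation (graphOfPairs (B ∪ T)) lam e -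
        correlation (graphOfPairs B) lam e ≤ κ) (hκ0 : 0 ≤ κ) :
    (1 - δ) * (log 2 - binEntropy α) - log 2 / #F ≤ n * (lam * κ) := by
  classical
  have hF' : (0 : ℝ) < #F := by exact_mod_cast hF
  have hltT : ∀ T ⊆ F, ∀ e ∈ B ∪ T, e.1 < e.2 := fun T hT e he =>
    hlt e (union_subset_union_right hT he)
  have hfano := fano_of_kl_le F.powerset (powerset_nonempty F)
    (fun T (X : Samples n p) => sampleProb (graphOfPairs (B ∪ T)) lam X)
    (fun X => sampleProb (graphOfPairs B) lam X)
    (fun T X => ¬ q < editDist (graphOfPairs (B ∪ T)) (est X))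
    (K := n * (lam * (#F * κ))) (L := #F * (log 2 - binEntropy α)) (δ := δ)
    (fun T _ X => prod_pos fun t _ => isingProb_pos _ _ _)
    (fun T _ => sum_prod_eq_one _ (sum_isingProb _ _))
    (fun X => prod_pos fun t _ => isingProb_pos _ _ _)
    (sum_prod_eq_one _ (sum_isingProb _ _))
    (mul_nonneg hF'.le (sub_nonneg.2 binEntropy_le_log_two)) ?_ ?_ ?_
  · have e1 : (1 - δ) * (log 2 - binEntropy α) - log 2 / #F =
        ((1 - δ) * (#F * (log 2 - binEntropy α)) - log 2) / #F := by field_simp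
    rw [e1, div_le_iff₀ hF']
    linarith
  · intro T hT
    rw [mem_powerset] at hT
    refine (kl_pi_eq _ _ (isingProb_pos _ lam) (isingProb_pos _ lam)
      (sum_isingProb _ lam)).trans_le (mul_le_mul_of_nonneg_left ?_ (Nat.cast_nonneg n))
    refine (kl_isingProb_le B T (hdisj.mono_right hT) (hltT T hT) lam).trans
      (mul_le_mul_of_nonneg_left ?_ hlam)
    refine (sum_le_card_nsmul T _ κ (hκ T hT)).trans ?_
    rw [nsmul_eq_mul]
    exact mul_le_mul_of_nonneg_right (by exact_mod_cast card_le_card hT) hκ0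
  · intro X
    have e1 : ((#F.powerset : ℕ) : ℝ) * exp (-(#F * (log 2 - binEntropy α))) =
        exp (#F * binEntropy α) := by
      have : (2 : ℝ) ^ #F = exp (#F * log 2) := by
        rw [← log_pow, exp_log (by positivity)]
      rw [card_powerset]
      push_cast
      rw [this, ← exp_add]
      ring_nf
    rw [e1]
    refine le_trans ?_ (card_powerset_filter_card_le F q h0 h1 hq)
    refine Nat.cast_le.2 (le_trans (card_le_card ?_) (card_close_le B F (edgePairs (est X)) hdisj q))
    intro T hT
    rw [mem_filter, mem_powerset, not_lt, editDist_eq] at hT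
    rw [mem_filter, mem_powerset]
    rwa [edgePairs_graphOfPairs (hltT T hT.1)] at hT
  · intro T hT
    rw [mem_powerset] at hT
    have hmem : graphOfPairs (B ∪ T) ∈ edgeBoundedClass p k := by
      change (graphOfPairs (B ∪ T)).edgeSet.ncard ≤ k
      rw [ncard_edgeSet_eq, edgePairs_graphOfPairs (hltT T hT)]
      exact (card_union_le _ _).trans ((Nat.add_le_add_left (card_le_card hT) _).trans hcard)
    have h := (worstCaseError_ge est lam q _ hmem).trans herr
    have hone : ∑ X : Samples n p, sampleProb (graphOfPairs (B ∪ T)) lam X = 1 :=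
      sum_prod_eq_one _ (sum_isingProb _ _)
    have hsplit : (∑ X : Samples n p, if ¬ q < editDist (graphOfPairs (B ∪ T)) (est X) then
        sampleProb (graphOfPairs (B ∪ T)) lam X else 0) +
        errorProb est lam q (graphOfPairs (B ∪ T)) = 1 := by
      rw [errorProb, ← sum_add_distrib, ← hone]
      refine sum_congr rfl fun X _ => ?_
      by_cases hX : q < editDist (graphOfPairs (B ∪ T)) (est X) <;> simp [hX]
    linarith

/-! ### Correlations under a degree bound -/

/-- The configuration with spin `-1` at `i` and `1` elsewhere; multiplying by it flips `x_i`. -/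
def flipAt {p : ℕ} (i : Fin p) : SpinConfig p := Pi.mulSingle i (-1)

theorem spin_mul {p : ℕ} (x y : SpinConfig p) (i : Fin p) :
    spin (x * y) i = spin x i * spin y i := by
  simp [spin]

theorem spin_flipAt {p : ℕ} (i j : Fin p) : spin (flipAt i) j = if j = i then -1 else 1 := by
  by_cases h : j = i
  · subst h; simp [spin, flipAt]
  · simp [spin, flipAt, h]

theorem spin_eq {p : ℕ} (x : SpinConfig p) (i : Fin p) : spin x i = 1 ∨ spin x i = -1 := by
  rcases Int.units_eq_one_or (x i) with h | h <;> simp [spin, h]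

theorem spin_mul_spin_eq {p : ℕ} (x : SpinConfig p) (i j : Fin p) :
    spin x i * spin x j = 1 ∨ spin x i * spin x j = -1 := by
  rcases spin_eq x i with h | h <;> rcases spin_eq x j with h' | h' <;> simp [h, h']

theorem correlation_le_one {p : ℕ} (G : SimpleGraph (Fin p)) (lam : ℝ) (e : Fin p × Fin p) :
    correlation G lam e ≤ 1 := by
  rw [← sum_isingProb G lam]
  refine sum_le_sum fun x _ => mul_le_of_le_one_right (isingProb_pos _ _ _).le ?_
  rcases spin_mul_spin_eq x e.1 e.2 with h | h <;> linarith

theorem correlation_empty {p : ℕ} (lam : ℝ) (e : Fin p × Fin p) (he : e.1 < e.2) :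
    correlation (graphOfPairs (∅ : Finset (Fin p × Fin p))) lam e = 0 := by
  have hw : ∀ x : SpinConfig p, isingExponent (graphOfPairs ∅) lam x = 0 := fun x => by
    rw [isingExponent_eq, edgePairs_graphOfPairs (by simp)]; simp
  have h : correlation (graphOfPairs ∅) lam e = -correlation (graphOfPairs ∅) lam e := by
    conv_lhs => rw [correlation, ← Equiv.sum_comp (Equiv.mulRight (flipAt e.1))]
    rw [correlation, ← sum_neg_distrib]
    refine sum_congr rfl fun x _ => ?_
    simp only [isingProb, hw, Equiv.coe_mulRight, spin_mul, spin_flipAt, if_neg he.ne', if_true]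
    ring
  linarith

/-- The part of the interaction energy carried by the edges at `i`. -/
def localEnergy {p : ℕ} (E : Finset (Fin p × Fin p)) (i : Fin p) (x : SpinConfig p) : ℝ :=
  ∑ e ∈ E with e.1 = i ∨ e.2 = i, spin x e.1 * spin x e.2

theorem spin_mul_spin_mul_flipAt {p : ℕ} (x : SpinConfig p) (i : Fin p) {e : Fin p × Fin p}
    (he : e.1 < e.2) : spin (x * flipAt i) e.1 * spin (x * flipAt i) e.2 =
      if e.1 = i ∨ e.2 = i then -(spin x e.1 * spin x e.2) else spin x e.1 * spin x e.2 := by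
  simp only [spin_mul, spin_flipAt]
  by_cases h1 : e.1 = i <;> by_cases h2 : e.2 = i
  · exact absurd (h1.trans h2.symm) he.ne
  all_goals simp [h1, h2]

theorem sum_spin_mul_flipAt {p : ℕ} {E : Finset (Fin p × Fin p)} (hE : ∀ e ∈ E, e.1 < e.2)
    (i : Fin p) (x : SpinConfig p) :
    ∑ e ∈ E, spin (x * flipAt i) e.1 * spin (x * flipAt i) e.2 =
      ∑ e ∈ E, spin x e.1 * spin x e.2 - 2 * localEnergy E i x := by
  rw [localEnergy, sum_filter, mul_sum, ← sum_sub_distrib]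
  refine sum_congr rfl fun e he => ?_
  rw [spin_mul_spin_mul_flipAt x i (hE e he)]
  split_ifs <;> ring

theorem localEnergy_mul_flipAt {p : ℕ} {E : Finset (Fin p × Fin p)} (hE : ∀ e ∈ E, e.1 < e.2)
    {i j : Fin p} (hij : (i, j) ∈ E) (x : SpinConfig p) :
    localEnergy E j (x * flipAt i) = localEnergy E j x - 2 * (spin x i * spin x j) := by
  have hlt := hE _ hij
  have h : ∀ e ∈ E.filter (fun e => e.1 = j ∨ e.2 = j),
      spin (x * flipAt i) e.1 * spin (x * flipAt i) e.2 =
        spin x e.1 * spin x e.2 - if e = (i, j) then 2 * (spin x i * spin x j) else 0 := by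
    rintro ⟨a, b⟩ he
    rw [mem_filter] at he
    have hab := hE _ he.1
    rw [spin_mul_spin_mul_flipAt x i hab]
    simp only [Prod.mk.injEq] at *
    by_cases h : a = i ∧ b = j
    · obtain ⟨rfl, rfl⟩ := h
      simp; ring
    · rw [if_neg h, if_neg, sub_zero]
      rintro (rfl | rfl)
      · rcases he.2 with h2 | h2
        · exact hlt.ne h2
        · exact h ⟨rfl, h2⟩
      · rcases he.2 with h2 | h2
        · subst h2; exact absurd hab hlt.le.not_gt
        · exact hlt.ne h2
  rw [localEnergy, sum_congr rfl h, sum_sub_distrib, sum_ite_eq', if_pos, localEnergy]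
  rw [mem_filter]
  exact ⟨hij, Or.inr rfl⟩

theorem abs_localEnergy_sub_le {p : ℕ} {E : Finset (Fin p × Fin p)} {i : Fin p} {m : ℕ}
    (hdeg : #{e ∈ E | e.1 = i ∨ e.2 = i} ≤ m + 1) {e : Fin p × Fin p} (he : e ∈ E)
    (hei : e.1 = i ∨ e.2 = i) (x : SpinConfig p) :
    |localEnergy E i x - spin x e.1 * spin x e.2| ≤ m := by
  have hmem : e ∈ E.filter (fun e => e.1 = i ∨ e.2 = i) := mem_filter.2 ⟨he, hei⟩
  rw [localEnergy, ← add_sum_erase _ _ hmem, add_sub_cancel_left]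
  refine (abs_sum_le_sum_abs _ _).trans ((sum_le_card_nsmul _ _ 1 fun e' _ => ?_).trans ?_)
  · rcases spin_mul_spin_eq x e'.1 e'.2 with h | h <;> simp [h]
  · rw [card_erase_of_mem hmem, nsmul_eq_mul, mul_one]
    exact_mod_cast Nat.sub_le_of_le_add hdeg

/-- The four Gibbs weights of a pair of neighbouring spins: given the other spins, the two
configurations in which the pair agrees weigh at most `exp (2 lam) cosh (2 lam m)` times the two in
which it disagrees, where `u` and `v` are the fields that the other neighbours exert. -/
theorem one_add_exp_le {lam u v m : ℝ} (hlam : 0 ≤ lam) (hu : |u| ≤ m) (hv : |v| ≤ m) :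
    1 + exp (-2 * lam * (u + v)) ≤ exp (2 * lam) * cosh (2 * lam * m) *
      (exp (-2 * lam * (1 + u)) + exp (-2 * lam * (1 + v))) := by
  have hc : cosh (lam * (u + v)) ≤ cosh (2 * lam * m) := by
    have hm : 0 ≤ m := (abs_nonneg u).trans hu
    rw [cosh_le_cosh, abs_mul, abs_of_nonneg hlam, abs_of_nonneg (by positivity : 0 ≤ 2 * lam * m)]
    have := abs_add_le u v
    nlinarith
  have h1 : 1 ≤ cosh (lam * (u - v)) := one_le_cosh _
  have e1 : 1 + exp (-2 * lam * (u + v)) = exp (-lam * (u + v)) * (2 * cosh (lam * (u + v))) := by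
    rw [cosh_eq, mul_div_cancel₀ _ two_ne_zero, mul_add (rexp _), ← exp_add, ← exp_add]
    congr 1
    · rw [← exp_zero]; ring_nf
    · ring_nf
  have e2 : exp (-2 * lam * (1 + u)) + exp (-2 * lam * (1 + v)) =
      exp (-2 * lam) * (exp (-lam * (u + v)) * (2 * cosh (lam * (u - v)))) := by
    rw [cosh_eq, mul_div_cancel₀ _ two_ne_zero, mul_add (rexp _), mul_add (rexp _), ← exp_add, ← exp_add,
      ← exp_add, ← exp_add, add_comm]
    ring_nf
  have e3 : exp (2 * lam) * exp (-2 * lam) = 1 := by rw [← exp_add]; simp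
  rw [e1, e2]
  calc exp (-lam * (u + v)) * (2 * cosh (lam * (u + v)))
      ≤ exp (-lam * (u + v)) * (2 * (cosh (2 * lam * m) * cosh (lam * (u - v)))) := by
        gcongr
        nlinarith [cosh_pos (2 * lam * m)]
    _ = (exp (2 * lam) * exp (-2 * lam)) *
          (exp (-lam * (u + v)) * (2 * (cosh (2 * lam * m) * cosh (lam * (u - v))))) := by
        rw [e3, one_mul]
    _ = _ := by ring

/-- In a graph with degrees at most `m + 1`, the correlation along an edge is at most what it would
be if the `m` other neighbours of each endpoint were all aligned. The bound compares a
configuration with those obtained by flipping one or both endpoints. -/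
theorem correlation_le {p : ℕ} {E : Finset (Fin p × Fin p)} (hE : ∀ e ∈ E, e.1 < e.2)
    {m : ℕ} (hdeg : ∀ i, #{e ∈ E | e.1 = i ∨ e.2 = i} ≤ m + 1) {lam : ℝ} (hlam : 0 ≤ lam)
    {e : Fin p × Fin p} (he : e ∈ E) :
    correlation (graphOfPairs E) lam e ≤
      (exp (2 * lam) * cosh (2 * lam * m) - 1) / (exp (2 * lam) * cosh (2 * lam * m) + 1) := by
  obtain ⟨i, j⟩ := e
  set R := exp (2 * lam) * cosh (2 * lam * m) with hR
  have hRpos : 0 < R := mul_pos (exp_pos _) (cosh_pos _)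
  have hlt : i < j := hE _ he
  set w : SpinConfig p → ℝ := fun x => isingProb (graphOfPairs E) lam x with hw
  set H : SpinConfig p → ℝ := fun x => ∑ e ∈ E, spin x e.1 * spin x e.2 with hH
  have hwH : ∀ x, w x = exp (lam * H x) / isingPartition (graphOfPairs E) lam := by
    intro x
    simp only [hw, hH]
    rw [isingProb, isingExponent_eq, edgePairs_graphOfPairs hE]
  -- `S` and `D` are the probabilities that the two spins agree and disagree.
  set S := ∑ x, if spin x i * spin x j = 1 then w x else 0 with hS
  set D := ∑ x, if spin x i * spin x j = 1 then 0 else w x with hD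
  have hSD : S + D = 1 := by
    rw [← sum_isingProb (graphOfPairs E) lam, hS, hD, ← sum_add_distrib]
    refine sum_congr rfl fun x _ => ?_
    split_ifs <;> simp [hw]
  have hcorr : correlation (graphOfPairs E) lam (i, j) = S - D := by
    rw [correlation, hS, hD, ← sum_sub_distrib]
    refine sum_congr rfl fun x _ => ?_
    rcases spin_mul_spin_eq x i j with h | h
    · simp [h, hw]
    · simp only [h, hw]; norm_num
  have hfi : ∀ x, spin (x * flipAt i) i * spin (x * flipAt i) j = -(spin x i * spin x j) := by
    intro x
    simp [spin_mul, spin_flipAt, hlt.ne']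
  have hfj : ∀ x, spin (x * flipAt j) i * spin (x * flipAt j) j = -(spin x i * spin x j) := by
    intro x
    simp [spin_mul, spin_flipAt, hlt.ne]
  have hDi : D = ∑ x, if spin x i * spin x j = 1 then w (x * flipAt i) else 0 := by
    rw [hD, ← Equiv.sum_comp (Equiv.mulRight (flipAt i))]
    refine sum_congr rfl fun x _ => ?_
    simp only [Equiv.coe_mulRight, hfi]
    rcases spin_mul_spin_eq x i j with h | h <;> rw [h] <;> norm_num
  have hDj : D = ∑ x, if spin x i * spin x j = 1 then w (x * flipAt j) else 0 := by
    rw [hD, ← Equiv.sum_comp (Equiv.mulRight (flipAt j))]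
    refine sum_congr rfl fun x _ => ?_
    simp only [Equiv.coe_mulRight, hfj]
    rcases spin_mul_spin_eq x i j with h | h <;> rw [h] <;> norm_num
  have hSij : S = ∑ x, if spin x i * spin x j = 1 then w (x * flipAt i * flipAt j) else 0 := by
    rw [hS, ← Equiv.sum_comp (Equiv.mulRight (flipAt j)),
      ← Equiv.sum_comp (Equiv.mulRight (flipAt i))]
    refine sum_congr rfl fun x _ => ?_
    simp only [Equiv.coe_mulRight, hfi, hfj, neg_neg]
  have hpt : ∀ x, (if spin x i * spin x j = 1 then w x else 0) +
      (if spin x i * spin x j = 1 then w (x * flipAt i * flipAt j) else 0) ≤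
      R * ((if spin x i * spin x j = 1 then w (x * flipAt i) else 0) +
        (if spin x i * spin x j = 1 then w (x * flipAt j) else 0)) := by
    intro x
    by_cases hx : spin x i * spin x j = 1
    swap
    · simp [hx]
    simp only [if_pos hx]
    have hu := abs_localEnergy_sub_le (hdeg i) he (Or.inl rfl) x
    have hv := abs_localEnergy_sub_le (hdeg j) he (Or.inr rfl) x
    simp only [hx] at hu hv
    have hin := one_add_exp_le hlam hu hv
    have h1 : H (x * flipAt i) = H x - 2 * localEnergy E i x := sum_spin_mul_flipAt hE i x
    have h2 : H (x * flipAt j) = H x - 2 * localEnergy E j x := sum_spin_mul_flipAt hE j x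
    have h3 : H (x * flipAt i * flipAt j) =
        H x - 2 * localEnergy E i x - 2 * (localEnergy E j x - 2) := by
      have := sum_spin_mul_flipAt hE j (x * flipAt i)
      rw [localEnergy_mul_flipAt hE he, hx, mul_one] at this
      simp only [hH] at this h1 ⊢
      rw [this, h1]
    rw [hwH, hwH, hwH, hwH, h1, h2, h3, ← add_div, ← add_div, ← mul_div_assoc]
    refine div_le_div_of_nonneg_right ?_ (isingPartition_pos _ _).le
    have := mul_le_mul_of_nonneg_left hin (exp_pos (lam * H x)).le
    calc _ = exp (lam * H x) * (1 + exp (-2 * lam * (localEnergy E i x - 1 +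
          (localEnergy E j x - 1)))) := by
          rw [mul_add, mul_one, ← exp_add]; ring_nf
      _ ≤ _ := this
      _ = R * (exp (lam * H x) * exp (-2 * lam * (1 + (localEnergy E i x - 1))) +
          exp (lam * H x) * exp (-2 * lam * (1 + (localEnergy E j x - 1)))) := by
          rw [hR]; ring
      _ = _ := by rw [← exp_add, ← exp_add]; ring_nf
  have hsum := sum_le_sum fun x (_ : x ∈ univ) => hpt x
  rw [sum_add_distrib, ← mul_sum, sum_add_distrib, ← hS, ← hSij, ← hDi, ← hDj] at hsum
  rw [hcorr, le_div_iff₀ (by linarith)]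
  nlinarith

/-! ### Correlations in complete bipartite graphs -/

/-- The configurations whose spins on `U` are all `1` form a fraction `2 ^ (-|U|)` of all. -/
theorem card_fixed_mul {p : ℕ} (U : Finset (Fin p)) :
    #(Fintype.piFinset fun v => if v ∈ U then ({1} : Finset ℤˣ) else univ) * 2 ^ #U = 2 ^ p := by
  have h : (2 : ℕ) ^ #U = ∏ v : Fin p, if v ∈ U then 2 else 1 := by
    rw [prod_ite_mem, univ_inter, prod_const]
  rw [Fintype.card_piFinset, h, ← prod_mul_distrib]
  have : ∀ v : Fin p, #(if v ∈ U then ({1} : Finset ℤˣ) else univ) *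
      (if v ∈ U then 2 else 1) = 2 := by
    intro v
    split_ifs <;> simp
  rw [prod_congr rfl fun v _ => this v]
  simp

theorem sum_spin_flipAt_of_mem {p : ℕ} {L : Finset (Fin p)} {i : Fin p} (hi : i ∈ L)
    (x : SpinConfig p) : ∑ v ∈ L, spin (x * flipAt i) v = ∑ v ∈ L, spin x v - 2 * spin x i := by
  have : ∀ v ∈ L, spin (x * flipAt i) v = spin x v - if v = i then 2 * spin x i else 0 := by
    intro v _
    rw [spin_mul, spin_flipAt]
    split_ifs with h
    · subst h; ring
    · ring
  rw [sum_congr rfl this, sum_sub_distrib, sum_ite_eq' , if_pos hi]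

theorem sum_spin_flipAt_of_notMem {p : ℕ} {R : Finset (Fin p)} {i : Fin p} (hi : i ∉ R)
    (x : SpinConfig p) : ∑ v ∈ R, spin (x * flipAt i) v = ∑ v ∈ R, spin x v := by
  refine sum_congr rfl fun v hv => ?_
  rw [spin_mul, spin_flipAt, if_neg (by rintro rfl; exact hi hv), mul_one]

theorem abs_sum_spin_le {p : ℕ} (L : Finset (Fin p)) (x : SpinConfig p) :
    |∑ v ∈ L, spin x v| ≤ #L := by
  refine (abs_sum_le_sum_abs _ _).trans ((sum_le_card_nsmul _ _ 1 fun v _ => ?_).trans ?_)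
  · rcases spin_eq x v with h | h <;> simp [h]
  · simp

/-- In the Ising model on the complete bipartite graph with sides `L` and `R` of size `a`, two
spins of the side `L` disagree with probability at most `4 exp (-lam a / 2)`; stated for the
unnormalized weights. -/
theorem sum_exp_mul_one_sub_le {p a : ℕ} (ha : 1 ≤ a) {L R : Finset (Fin p)}
    (hLR : Disjoint L R) (hL : #L = a) (hR : #R = a) {i j : Fin p} (hi : i ∈ L) (hj : j ∈ L)
    {lam : ℝ} (hlam : 0 ≤ lam) :
    ∑ x : SpinConfig p, exp (lam * ((∑ v ∈ L, spin x v) * ∑ v ∈ R, spin x v)) *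
        (1 - spin x i * spin x j) ≤
      8 * exp (-(lam * a / 2)) *
        ∑ x : SpinConfig p, exp (lam * ((∑ v ∈ L, spin x v) * ∑ v ∈ R, spin x v)) := by
  set w : SpinConfig p → ℝ :=
    fun x => exp (lam * ((∑ v ∈ L, spin x v) * ∑ v ∈ R, spin x v)) with hw
  have hw0 : ∀ x, 0 < w x := fun x => exp_pos _
  set Z := ∑ x, w x with hZ
  have hZ0 : 0 < Z := sum_pos (fun x _ => hw0 x) univ_nonempty
  set y := exp (-(lam * a / 4)) with hy
  have hy0 : 0 < y := exp_pos _
  have hy2 : exp (-(lam * a / 2)) = y ^ 2 := by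
    rw [hy, ← exp_nat_mul]; congr 1; push_cast; ring
  change ∑ x, w x * (1 - spin x i * spin x j) ≤ 8 * exp (-(lam * a / 2)) * Z
  rw [hy2]
  have h01 : ∀ x : SpinConfig p, 0 ≤ 1 - spin x i * spin x j ∧ 1 - spin x i * spin x j ≤ 2 := by
    intro x
    rcases spin_mul_spin_eq x i j with h | h <;> rw [h] <;> norm_num
  -- For `y ≥ 1 / 2` the claimed bound on `1 - x_i x_j` is at least `2`.
  rcases le_or_gt (1 / 2) y with hyge | hylt
  · calc ∑ x, w x * (1 - spin x i * spin x j) ≤ ∑ x, w x * 2 :=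
          sum_le_sum fun x _ => mul_le_mul_of_nonneg_left (h01 x).2 (hw0 x).le
      _ = 2 * Z := by rw [← sum_mul, mul_comm]
      _ ≤ 8 * y ^ 2 * Z := mul_le_mul_of_nonneg_right (by nlinarith) hZ0.le
  -- Where `R` is weakly magnetized the weight is small; elsewhere disagreement is expensive.
  have hpt : ∀ x, w x * (1 - spin x i * spin x j) ≤
      2 * exp (lam * (a * a / 4)) + y ^ 2 * (2 * (w (x * flipAt i) + w (x * flipAt j))) := by
    intro x
    have hA := hw0 (x * flipAt i)
    have hB := hw0 (x * flipAt j)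
    rcases spin_mul_spin_eq x i j with hs | hs
    · rw [hs, sub_self, mul_zero]; positivity
    rw [hs]
    rcases le_or_gt (|∑ v ∈ R, spin x v|) (a / 4) with hsm | hbig
    · have : w x ≤ exp (lam * (a * a / 4)) := by
        refine exp_le_exp.2 (mul_le_mul_of_nonneg_left ?_ hlam)
        refine (le_abs_self _).trans ?_
        rw [abs_mul, mul_div_assoc]
        have := abs_sum_spin_le L x
        rw [hL] at this
        exact mul_le_mul this hsm (abs_nonneg _) (by positivity)
      have h2 : 0 ≤ y ^ 2 * (2 * (w (x * flipAt i) + w (x * flipAt j))) := by positivity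
      linarith
    · have hwi : ∀ u ∈ L, w (x * flipAt u) = w x * exp (-(2 * lam * (spin x u *
          ∑ v ∈ R, spin x v))) := by
        intro u hu
        simp only [hw]
        rw [sum_spin_flipAt_of_mem hu, sum_spin_flipAt_of_notMem (disjoint_left.1 hLR hu),
          ← exp_add]
        ring_nf
      -- Flipping the spin that opposes the magnetization of `R` multiplies the weight by
      -- `exp (2 lam |∑ v ∈ R, x_v|)`.
      have hex : ∃ u, (u = i ∨ u = j) ∧ spin x u * ∑ v ∈ R, spin x v = -|∑ v ∈ R, spin x v| := by
        rcases abs_cases (∑ v ∈ R, spin x v) with ⟨h, _⟩ | ⟨h, _⟩ <;> rw [h] <;>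
          rcases spin_eq x i with h1 | h1
        · exact ⟨j, Or.inr rfl, by rw [h1, one_mul] at hs; rw [hs]; ring⟩
        · exact ⟨i, Or.inl rfl, by rw [h1]; ring⟩
        · exact ⟨i, Or.inl rfl, by rw [h1]; ring⟩
        · exact ⟨j, Or.inr rfl, by
            have : spin x j = 1 := by rw [h1] at hs; linarith
            rw [this]; ring⟩
      obtain ⟨u, huij, hur⟩ := hex
      have hu : u ∈ L := by rcases huij with rfl | rfl <;> assumption
      have hu' : w x ≤ y ^ 2 * w (x * flipAt u) := by
        rw [hwi u hu, hur, ← hy2, mul_left_comm, ← exp_add]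
        refine le_mul_of_one_le_right (hw0 x).le (one_le_exp ?_)
        nlinarith
      have hsum : w (x * flipAt u) ≤ w (x * flipAt i) + w (x * flipAt j) := by
        rcases huij with rfl | rfl <;> linarith
      have := mul_le_mul_of_nonneg_left hsum (sq_nonneg y)
      have h2 : 0 < exp (lam * (a * a / 4)) := exp_pos _
      nlinarith
  have hsum := sum_le_sum fun x (_ : x ∈ univ) => hpt x
  have hflip : ∀ u : Fin p, ∑ x, w (x * flipAt u) = Z := fun u =>
    Equiv.sum_comp (Equiv.mulRight (flipAt u)) w
  simp only [sum_add_distrib, ← mul_sum, hflip, sum_const, nsmul_eq_mul] at hsum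
  have hcard : ((univ : Finset (SpinConfig p)).card : ℝ) = 2 ^ p := by
    rw [card_univ]; simp
  rw [hcard] at hsum
  -- The `C` configurations with all spins of `L ∪ R` equal to `1` bound `Z` from below.
  set C := #(Fintype.piFinset fun v => if v ∈ L ∪ R then ({1} : Finset ℤˣ) else univ) with hC
  have hCp : (C : ℝ) * 4 ^ a = 2 ^ p := by
    have := card_fixed_mul (L ∪ R)
    rw [card_union_of_disjoint hLR, hL, hR, ← two_mul, pow_mul] at this
    exact_mod_cast this
  have hZC : C * exp (lam * (a * a)) ≤ Z := by
    calc (C : ℝ) * exp (lam * (a * a)) =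
          ∑ x ∈ Fintype.piFinset fun v => if v ∈ L ∪ R then ({1} : Finset ℤˣ) else univ, w x := by
          rw [hC, ← nsmul_eq_mul, ← sum_const]
          refine sum_congr rfl fun x hx => ?_
          rw [Fintype.mem_piFinset] at hx
          have hx1 : ∀ v ∈ L ∪ R, spin x v = 1 := by
            intro v hv
            have := hx v
            rw [if_pos hv, mem_singleton] at this
            simp [spin, this]
          simp only [hw]
          rw [sum_congr rfl fun v hv => hx1 v (mem_union_left _ hv),
            sum_congr rfl fun v hv => hx1 v (mem_union_right _ hv)]
          simp [hL, hR]
      _ ≤ Z := sum_le_sum_of_subset_of_nonneg (subset_univ _) fun x _ _ => (hw0 x).le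
  have hpow : (4 * y ^ 3) ^ a ≤ 4 * y ^ 3 := by
    refine pow_le_of_le_one (by positivity) ?_ (by omega)
    nlinarith [mul_pos hy0 hy0]
  have hexp : exp (lam * (a * a / 4)) = exp (lam * (a * a)) * (y ^ 3) ^ a := by
    rw [hy, ← exp_nat_mul, ← exp_nat_mul, ← exp_add]
    congr 1
    push_cast
    ring
  have hsmall : 2 ^ p * (2 * exp (lam * (a * a / 4))) ≤ 4 * y ^ 2 * Z := by
    rw [← hCp, hexp]
    calc C * 4 ^ a * (2 * (exp (lam * (a * a)) * (y ^ 3) ^ a))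
        = 2 * ((4 * y ^ 3) ^ a * (C * exp (lam * (a * a)))) := by rw [mul_pow]; ring
      _ ≤ 2 * (4 * y ^ 3 * Z) := by gcongr
      _ ≤ 4 * y ^ 2 * Z := by
          have : 2 * (4 * y ^ 3) ≤ 4 * y ^ 2 := by nlinarith [mul_pos hy0 hy0]
          nlinarith
  linarith

theorem one_sub_correlation_le {p a : ℕ} (ha : 1 ≤ a) {L R : Finset (Fin p)}
    (hlt : ∀ u ∈ L, ∀ v ∈ R, u < v) (hL : #L = a) (hR : #R = a) {lam : ℝ} (hlam : 0 ≤ lam)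
    {e : Fin p × Fin p} (he : e.1 ∈ L ∧ e.2 ∈ L ∨ e.1 ∈ R ∧ e.2 ∈ R) :
    1 - correlation (graphOfPairs (L ×ˢ R)) lam e ≤ 8 * exp (-(lam * a / 2)) := by
  have hLR : Disjoint L R := disjoint_left.2 fun v hv hv' => (hlt v hv v hv').false
  have hE : ∀ e ∈ L ×ˢ R, e.1 < e.2 := fun e he =>
    hlt _ (mem_product.1 he).1 _ (mem_product.1 he).2
  have hZ := isingPartition_pos (graphOfPairs (L ×ˢ R)) lam
  have hexp : ∀ x, isingExponent (graphOfPairs (L ×ˢ R)) lam x =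
      lam * ((∑ v ∈ L, spin x v) * ∑ v ∈ R, spin x v) := fun x => by
    rw [isingExponent_eq, edgePairs_graphOfPairs hE, sum_mul_sum, sum_product]
  have h1 : 1 - correlation (graphOfPairs (L ×ˢ R)) lam e =
      (∑ x, exp (lam * ((∑ v ∈ L, spin x v) * ∑ v ∈ R, spin x v)) *
        (1 - spin x e.1 * spin x e.2)) / isingPartition (graphOfPairs (L ×ˢ R)) lam := by
    nth_rewrite 1 [← sum_isingProb (graphOfPairs (L ×ˢ R)) lam]
    rw [correlation, ← sum_sub_distrib, sum_div]
    refine sum_congr rfl fun x _ => ?_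
    rw [isingProb, hexp]
    ring
  rw [h1, div_le_iff₀ hZ, isingPartition]
  simp_rw [hexp]
  rcases he with he | he
  · exact sum_exp_mul_one_sub_le ha hLR hL hR he.1 he.2 hlam
  · simp_rw [mul_comm (∑ v ∈ L, spin _ v)]
    exact sum_exp_mul_one_sub_le ha hLR.symm hR hL he.1 he.2 hlam

/-! ### The two ensembles -/

theorem card_filter_lt_mul_two {β : Type*} [LinearOrder β] (S : Finset β) :
    #{e ∈ S ×ˢ S | e.1 < e.2} * 2 = #S * #S - #S := by
  rw [← offDiag_card, ← card_filter_add_card_filter_not (s := S.offDiag) (fun e => e.1 < e.2),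
    mul_two]
  congr 1
  · congr 1
    ext e
    simp only [mem_filter, mem_product, mem_offDiag]
    exact ⟨fun h => ⟨⟨h.1.1, h.1.2, h.2.ne⟩, h.2⟩, fun h => ⟨⟨h.1.1, h.1.2.1⟩, h.2⟩⟩
  · refine card_bij (fun e _ => e.swap) ?_ (fun _ _ _ _ h => Prod.swap_injective h) ?_
    · intro e he
      simp only [mem_filter, mem_product, mem_offDiag, Prod.fst_swap, Prod.snd_swap] at he ⊢
      exact ⟨⟨he.1.2, he.1.1, he.2.ne'⟩, he.2.le.not_gt⟩
    · intro e he
      simp only [mem_filter, mem_offDiag] at he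
      refine ⟨e.swap, ?_, Prod.swap_swap e⟩
      simp only [mem_filter, mem_product, Prod.fst_swap, Prod.snd_swap]
      exact ⟨⟨he.1.2.1, he.1.1⟩, lt_of_le_of_ne (not_lt.1 he.2) he.1.2.2.symm⟩

/-- The ensemble of graphs that contain the complete bipartite graph on two sides of size `a`,
together with arbitrary edges inside the two sides. The base graph forces the spins within a side
to agree, so the `a (a - 1)` free edges are nearly invisible. -/
theorem sampleSize_ge_of_bipartite {p k q n a : ℕ} (ha : 2 ≤ a) (hap : 2 * a ≤ p)
    (hak : 2 * (a * a) ≤ k) (est : Estimator n p) {lam δ α : ℝ} (hlam : 0 ≤ lam)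
    (herr : worstCaseError est lam q (edgeBoundedClass p k) ≤ δ)
    (h0 : 0 < α) (h1 : α ≤ 1 / 2) (hq : (q : ℝ) ≤ α * (a * (a - 1))) :
    (1 - δ) * (log 2 - binEntropy α) - log 2 / (a * (a - 1)) ≤
      n * (lam * (8 * exp (-(lam * a / 2)))) := by
  set L : Finset (Fin p) := univ.map (Fin.castLEEmb (show a ≤ p by omega)) with hLdef
  set R : Finset (Fin p) :=
    univ.map ((Fin.natAddEmb a).trans (Fin.castLEEmb (show a + a ≤ p by omega))) with hRdef
  have hL : #L = a := by simp [hLdef]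
  have hR : #R = a := by simp [hRdef]
  have hlt : ∀ u ∈ L, ∀ v ∈ R, u < v := by
    intro u hu v hv
    simp only [hLdef, hRdef, Finset.mem_map, mem_univ, true_and] at hu hv
    obtain ⟨u, rfl⟩ := hu
    obtain ⟨v, rfl⟩ := hv
    rw [Fin.lt_def]
    simp
    omega
  have hLR : Disjoint L R := disjoint_left.2 fun v hv hv' => (hlt v hv v hv').false
  set FL := {e ∈ L ×ˢ L | e.1 < e.2} with hFL
  set FR := {e ∈ R ×ˢ R | e.1 < e.2} with hFR
  have hdisj : Disjoint FL FR := disjoint_left.2 fun e he he' =>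
    disjoint_left.1 hLR (mem_product.1 (mem_filter.1 he).1).1
      (mem_product.1 (mem_filter.1 he').1).1
  have hcard : #(FL ∪ FR) = a * a - a := by
    have e1 : #FL * 2 = #L * #L - #L := card_filter_lt_mul_two L
    have e2 : #FR * 2 = #R * #R - #R := card_filter_lt_mul_two R
    rw [hL] at e1
    rw [hR] at e2
    rw [card_union_of_disjoint hdisj]
    omega
  have hsq : a ≤ a * a := Nat.le_mul_self a
  have hcardR : ((#(FL ∪ FR) : ℕ) : ℝ) = a * (a - 1) := by
    rw [hcard, Nat.cast_sub hsq]; push_cast; ring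
  have hF : ∀ e ∈ FL ∪ FR, e.1 < e.2 ∧ (e.1 ∈ L ∧ e.2 ∈ L ∨ e.1 ∈ R ∧ e.2 ∈ R) := by
    intro e he
    rcases mem_union.1 he with h | h <;> rw [mem_filter, mem_product] at h
    · exact ⟨h.2, Or.inl h.1⟩
    · exact ⟨h.2, Or.inr h.1⟩
  have h := sampleSize_lower_bound (k := k) est (L ×ˢ R) (FL ∪ FR) ?_ ?_ ?_ ?_ hlam herr h0 h1
    (κ := 8 * exp (-(lam * a / 2))) (by rwa [hcardR]) ?_ (by positivity)
  · rwa [hcardR] at h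
  · refine disjoint_left.2 fun e he he' => ?_
    rw [mem_product] at he
    rcases (hF e he').2 with h | h
    · exact disjoint_left.1 hLR h.2 he.2
    · exact disjoint_left.1 hLR he.1 h.1
  · intro e he
    rcases mem_union.1 he with h | h
    · exact hlt _ (mem_product.1 h).1 _ (mem_product.1 h).2
    · exact (hF e h).1
  · rw [card_product, hL, hR, hcard]; omega
  · rw [hcard]
    have : 2 * a ≤ a * a := Nat.mul_le_mul_right a ha
    omega
  · intro T hT e he
    have h := hF e (hT he)
    have h2 := one_sub_correlation_le (by omega) hlt hL hR hlam h.2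
    linarith [correlation_le_one (graphOfPairs (L ×ˢ R ∪ T)) lam e]

/-- A graph with `N` edges and degrees at most `D`, taken from the bipartite circulant graph that joins
`i` to `s + (i + t) % s` for `i < s = p / 2` and `t < D`. -/
theorem exists_pairs_degree_le {p D N : ℕ} (hD : D ≤ p / 2) (hN : N ≤ D * (p / 2)) :
    ∃ F : Finset (Fin p × Fin p), (∀ e ∈ F, e.1 < e.2) ∧ #F = N ∧
      ∀ v, #{e ∈ F | e.1 = v ∨ e.2 = v} ≤ D := by
  set s := p / 2 with hs
  rcases Nat.eq_zero_or_pos s with h0 | hpos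
  · refine ⟨∅, by simp, ?_, by simp⟩
    rw [h0, mul_zero] at hN
    simp; omega
  have : NeZero s := ⟨hpos.ne'⟩
  set l : Fin s → Fin p := fun i => ⟨i, by omega⟩ with hl
  set r : Fin s → Fin p := fun i => ⟨s + i, by omega⟩ with hr
  have hlinj : Function.Injective l := fun i j h => by
    simp only [hl, Fin.mk.injEq] at h; exact Fin.ext h
  have hrinj : Function.Injective r := fun i j h => by
    simp only [hr, Fin.mk.injEq] at h; exact Fin.ext (by omega)
  have hlr : ∀ i j, l i < r j := fun i j => by
    simp only [hl, hr, Fin.mk_lt_mk]; omega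
  set f : Fin s × Fin D → Fin p × Fin p := fun z => (l z.1, r (z.1 + Fin.castLE hD z.2)) with hf
  have hfinj : Function.Injective f := by
    rintro ⟨i, t⟩ ⟨i', t'⟩ h
    simp only [hf, Prod.mk.injEq] at h
    obtain rfl := hlinj h.1
    have := add_left_cancel (hrinj h.2)
    rw [(Fin.castLE_injective hD) this]
  obtain ⟨F, hFsub, hFcard⟩ := exists_subset_card_eq (s := univ.image f) (n := N) (by
    rw [card_image_of_injective _ hfinj]
    simpa [mul_comm] using hN)
  have hmem : ∀ e ∈ F, ∃ i t, e = (l i, r (i + Fin.castLE hD t)) := by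
    intro e he
    obtain ⟨⟨i, t⟩, _, h⟩ := mem_image.1 (hFsub he)
    exact ⟨i, t, h.symm⟩
  refine ⟨F, ?_, hFcard, fun v => ?_⟩
  · intro e he
    obtain ⟨i, t, rfl⟩ := hmem e he
    exact hlr _ _
  · by_cases hv : ∃ i, l i = v
    · obtain ⟨i, rfl⟩ := hv
      have hsub : {e ∈ F | e.1 = l i ∨ e.2 = l i} ⊆
          (univ : Finset (Fin D)).image fun t => (l i, r (i + Fin.castLE hD t)) := by
        intro e he
        rw [mem_filter] at he
        obtain ⟨i', t, rfl⟩ := hmem e he.1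
        rcases he.2 with h | h
        · obtain rfl := hlinj h
          exact mem_image_of_mem _ (mem_univ t)
        · exact absurd h (hlr _ _).ne'
      exact (card_le_card hsub).trans (card_image_le.trans_eq (by simp))
    · by_cases hv' : ∃ j, r j = v
      · obtain ⟨j, rfl⟩ := hv'
        have hsub : {e ∈ F | e.1 = r j ∨ e.2 = r j} ⊆
            (univ : Finset (Fin D)).image fun t => (l (j - Fin.castLE hD t), r j) := by
          intro e he
          rw [mem_filter] at he
          obtain ⟨i, t, rfl⟩ := hmem e he.1
          rcases he.2 with h | h
          · exact absurd h (hlr _ _).ne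
          · obtain rfl := hrinj h
            refine mem_image.2 ⟨t, mem_univ t, ?_⟩
            rw [add_sub_cancel_right]
        exact (card_le_card hsub).trans (card_image_le.trans_eq (by simp))
      · rw [filter_false_of_mem]
        · simp
        · intro e he h
          obtain ⟨i, t, rfl⟩ := hmem e he
          rcases h with h | h
          · exact hv ⟨_, h⟩
          · exact hv' ⟨_, h⟩

/-- The ensemble of all subgraphs of a graph with `N` edges and degrees at most `m + 1`, compared
with the empty graph, whose correlations vanish. -/
theorem sampleSize_ge_of_bounded_degree {p k q n m N : ℕ} (hm : m + 1 ≤ p / 2)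
    (hNm : N ≤ (m + 1) * (p / 2)) (hN : 0 < N) (hNk : N ≤ k) (est : Estimator n p)
    {lam δ α : ℝ} (hlam : 0 ≤ lam)
    (herr : worstCaseError est lam q (edgeBoundedClass p k) ≤ δ)
    (h0 : 0 < α) (h1 : α ≤ 1 / 2) (hq : (q : ℝ) ≤ α * N) :
    (1 - δ) * (log 2 - binEntropy α) - log 2 / N ≤
      n * (lam * ((exp (2 * lam) * cosh (2 * lam * m) - 1) /
        (exp (2 * lam) * cosh (2 * lam * m) + 1))) := by
  obtain ⟨F, hF, rfl, hdeg⟩ := exists_pairs_degree_le hm hNm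
  refine sampleSize_lower_bound (k := k) est ∅ F (disjoint_empty_left F) (by simpa using hF)
    (by simpa using hNk) hN hlam herr h0 h1 hq ?_ ?_
  · intro T hT e he
    rw [correlation_empty lam e (hF e (hT he)), sub_zero, empty_union]
    refine correlation_le (fun e he => hF e (hT he)) (fun v => ?_) hlam he
    exact (card_le_card (filter_subset_filter _ hT)).trans (hdeg v)
  · have := one_le_mul_of_one_le_of_one_le (one_le_exp (by positivity : 0 ≤ 2 * lam))
      (one_le_cosh (2 * lam * m))
    exact div_nonneg (by linarith) (by linarith)

end

/-! ### Asymptotics -/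

theorem log_two_sub_binEntropy_pos {x : ℝ} (hx : x < 1 / 2) : 0 < log 2 - binEntropy x :=
  sub_pos.2 (binEntropy_lt_log_two.2 (by norm_num at hx ⊢; exact hx.ne))

/-- The multiplicative error term: if an ensemble has `N` free edges among `k` with `k / N → ρ`,
the entropy term `log 2 - H(θ k / N)` and the correction `log 2 / N` of Fano's inequality may be
replaced by `log 2 - H(ρ θ)` at the price of a vanishing sequence not depending on `δ` and `κ`. -/
theorem exists_error_term {θ ρ : ℝ} (hθ : 0 < θ) (hρ : 0 < ρ) (hρθ : ρ * θ < 1 / 2)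
    (k N : ℕ → ℝ) (hN : Tendsto N atTop atTop)
    (hk : Tendsto (fun p => k p / N p) atTop (𝓝 ρ)) :
    ∃ ε : ℕ → ℝ, Tendsto ε atTop (𝓝 0) ∧ ∀ᶠ p in atTop,
      0 < θ * (k p / N p) ∧ θ * (k p / N p) ≤ 1 / 2 ∧ ∀ δ κ : ℝ, 0 ≤ δ → 0 ≤ κ →
        (1 - δ) * (log 2 - binEntropy (θ * (k p / N p))) - log 2 / N p ≤ κ →
        (log 2 - binEntropy (ρ * θ)) * (1 - δ - ε p) ≤ κ := by
  have hΔ := log_two_sub_binEntropy_pos hρθ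
  set Δ := log 2 - binEntropy (ρ * θ) with hΔdef
  have hα : Tendsto (fun p => θ * (k p / N p)) atTop (𝓝 (ρ * θ)) := by
    rw [mul_comm ρ]; exact hk.const_mul θ
  have hh : Tendsto (fun p => log 2 - binEntropy (θ * (k p / N p))) atTop (𝓝 Δ) :=
    tendsto_const_nhds.sub ((binEntropy_continuous.tendsto _).comp hα)
  refine ⟨fun p => (|Δ - (log 2 - binEntropy (θ * (k p / N p)))| + |log 2 / N p|) / Δ, ?_, ?_⟩
  · have h1 : Tendsto (fun p => |Δ - (log 2 - binEntropy (θ * (k p / N p)))|) atTop (𝓝 0) := by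
      simpa using (tendsto_const_nhds (x := Δ)).sub hh |>.abs
    have h2 : Tendsto (fun p => |log 2 / N p|) atTop (𝓝 0) := by
      simpa using (hN.const_div_atTop (log 2)).abs
    simpa using (h1.add h2).div_const Δ
  · filter_upwards [hα.eventually_const_lt (mul_pos hρ hθ), hα.eventually_lt_const hρθ]
      with p hp1 hp2
    refine ⟨hp1, hp2.le, fun δ κ hδ hκ h => ?_⟩
    set Δ' := log 2 - binEntropy (θ * (k p / N p))
    have e1 : Δ * (1 - δ - (|Δ - Δ'| + |log 2 / N p|) / Δ) =
        (1 - δ) * Δ - |Δ - Δ'| - |log 2 / N p| := by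
      field_simp; ring
    rw [e1]
    have h1 := le_abs_self (Δ - Δ')
    have h2 := le_abs_self (log 2 / N p)
    have h3 := abs_nonneg (log 2 / N p)
    have h4 := abs_nonneg (Δ - Δ')
    rcases le_total 1 δ with hd | hd
    · nlinarith
    · nlinarith

theorem tendsto_edgeBound_atTop {c ν : ℝ} (hc : 0 < c) (hν : 0 ≤ ν) :
    Tendsto (fun p => (edgeBound c ν p : ℝ)) atTop atTop := by
  refine tendsto_natCast_atTop_atTop.comp (tendsto_nat_floor_atTop.comp ?_)
  exact ((tendsto_rpow_atTop (by linarith)).comp tendsto_natCast_atTop_atTop).const_mul_atTop hc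

theorem edgeBound_le {c : ℝ} (hc : 0 < c) (ν : ℝ) (p : ℕ) :
    (edgeBound c ν p : ℝ) ≤ c * (p : ℝ) ^ (1 + ν) :=
  Nat.floor_le (by positivity)

theorem eventually_const_mul_rpow_le {ν : ℝ} (hν : ν < 1) (C : ℝ) :
    ∀ᶠ p : ℕ in atTop, C * (p : ℝ) ^ ν ≤ p := by
  have h : Tendsto (fun p : ℕ => C * (p : ℝ) ^ (-(1 - ν))) atTop (𝓝 0) := by
    simpa using ((tendsto_rpow_neg_atTop (sub_pos.2 hν)).comp
      tendsto_natCast_atTop_atTop).const_mul C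
  filter_upwards [h.eventually_le_const one_pos, eventually_gt_atTop 0] with p hp hp0
  have hp0' : (0 : ℝ) < p := by exact_mod_cast hp0
  have e : (p : ℝ) ^ ν = (p : ℝ) ^ (-(1 - ν)) * p := by
    nth_rewrite 3 [← rpow_one (p : ℝ)]
    rw [← rpow_add hp0']
    ring_nf
  rw [e, ← mul_assoc]
  exact mul_le_of_le_one_left hp0'.le hp

theorem worstCaseError_nonneg {n p : ℕ} (est : Estimator n p) (lam : ℝ) (q k : ℕ) :
    0 ≤ worstCaseError est lam q (edgeBoundedClass p k) :=
  Real.iSup_nonneg fun _ => errorProb_nonneg _ _ _ _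

/-- The first term of the maximum. The free edges are half of all, hence the entropy at `2 θ`. -/
theorem bipartite_bound {c ν θ : ℝ} (hc : 0 < c) (hν0 : 0 ≤ ν) (hν1 : ν < 1)
    (hθ0 : 0 < θ) (hθ1 : θ < 1 / 4) :
    ∃ ε : ℕ → ℝ, Tendsto ε atTop (𝓝 0) ∧ ∀ᶠ p in atTop,
      ∀ (n : ℕ) (lam δ : ℝ) (est : Estimator n p), 0 < lam →
        worstCaseError est lam (distortionLevel θ (edgeBound c ν p))
          (edgeBoundedClass p (edgeBound c ν p)) ≤ δ →
        exp (lam * (√((edgeBound c ν p : ℝ) / 2) - 2) / 2) * (log 2 - binEntropy (2 * θ)) /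
            (6 * lam * (edgeBound c ν p : ℝ)) * (1 - δ - ε p) ≤ n := by
  set k : ℕ → ℕ := edgeBound c ν with hk
  -- The base graph has `a ^ 2 ≤ k / 2` edges, and `a (a - 1) ~ k / 2` further edges are free.
  set a : ℕ → ℕ := fun p => ⌊√((k p : ℝ) / 2)⌋₊ with ha
  have hkinf : Tendsto (fun p => (k p : ℝ)) atTop atTop := tendsto_edgeBound_atTop hc hν0
  have hsqrt : Tendsto (fun p => √((k p : ℝ) / 2)) atTop atTop :=
    tendsto_sqrt_atTop.comp (hkinf.atTop_div_const two_pos)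
  have hainf : Tendsto a atTop atTop := tendsto_nat_floor_atTop.comp hsqrt
  have hainf' : Tendsto (fun p => (a p : ℝ)) atTop atTop :=
    tendsto_natCast_atTop_atTop.comp hainf
  have hratio : Tendsto (fun p => (a p : ℝ) / √((k p : ℝ) / 2)) atTop (𝓝 1) :=
    tendsto_nat_floor_div_atTop.comp hsqrt
  have hNinf : Tendsto (fun p => (a p : ℝ) * (a p - 1)) atTop atTop :=
    hainf'.atTop_mul_atTop₀ (tendsto_atTop_add_const_right _ (-1) hainf')
  have hkN : Tendsto (fun p => (k p : ℝ) / (a p * (a p - 1))) atTop (𝓝 2) := by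
    have h1 : Tendsto (fun p => ((a p : ℝ) / √((k p : ℝ) / 2)) ^ 2 / 2 * (1 - 1 / a p)) atTop
        (𝓝 (1 ^ 2 / 2 * (1 - 0))) :=
      ((hratio.pow 2).div_const 2).mul (tendsto_const_nhds.sub (hainf'.const_div_atTop 1))
    have h2 := h1.inv₀ (by norm_num)
    rw [show ((1 : ℝ) ^ 2 / 2 * (1 - 0))⁻¹ = 2 by norm_num] at h2
    refine h2.congr' ?_
    filter_upwards [hkinf.eventually_gt_atTop 0, hainf'.eventually_gt_atTop 1] with p hp ha1
    have : (a p : ℝ) - 1 ≠ 0 := by linarith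
    have : (a p : ℝ) ≠ 0 := by linarith
    rw [div_pow, sq_sqrt (by positivity)]
    field_simp
  obtain ⟨ε, hε, hev⟩ := exists_error_term hθ0 two_pos (by linarith) (fun p => (k p : ℝ))
    (fun p => (a p : ℝ) * (a p - 1)) hNinf hkN
  refine ⟨ε, hε, ?_⟩
  filter_upwards [hev, hainf.eventually_ge_atTop 2, hkinf.eventually_ge_atTop 2,
    eventually_const_mul_rpow_le hν1 (2 * c), eventually_gt_atTop 0] with
    p ⟨hα0, hα1, hεp⟩ ha2 hk2 hcp hp0 n lam δ est hlam herr
  have hp0' : (0 : ℝ) < p := by exact_mod_cast hp0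
  have ha_le : (a p : ℝ) ≤ √((k p : ℝ) / 2) := Nat.floor_le (sqrt_nonneg _)
  have ha_gt : √((k p : ℝ) / 2) < a p + 1 := Nat.lt_floor_add_one _
  have ha2' : (2 : ℝ) ≤ a p := by exact_mod_cast ha2
  have hsq : (a p : ℝ) * a p ≤ k p / 2 := by
    rw [← sq]
    exact (le_sqrt (by positivity) (by positivity)).1 ha_le
  have hak : 2 * (a p * a p) ≤ k p := by
    have : (2 : ℝ) * (a p * a p) ≤ k p := by linarith
    exact_mod_cast this
  have hap : 2 * a p ≤ p := by
    have h1 := edgeBound_le hc ν p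
    rw [rpow_add hp0', rpow_one] at h1
    have h2 : (2 * a p : ℝ) ^ 2 ≤ (p : ℝ) ^ 2 := by
      have h3 : (k p : ℝ) ≤ c * (p * (p : ℝ) ^ ν) := h1
      nlinarith
    have := (sq_le_sq₀ (by positivity) hp0'.le).1 h2
    exact_mod_cast this
  have hN0 : (0 : ℝ) < a p * (a p - 1) := by nlinarith
  have hb := sampleSize_ge_of_bipartite ha2 hap hak est hlam.le herr hα0 hα1 (by
    rw [mul_assoc, div_mul_cancel₀ _ hN0.ne']
    exact Nat.floor_le (by positivity))
  have hδ : 0 ≤ δ := (worstCaseError_nonneg _ _ _ _).trans herr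
  have hmain := hεp δ _ hδ (by positivity) hb
  have hexp : 8 * exp (-(lam * a p / 2)) ≤
      6 * k p / exp (lam * (√((k p : ℝ) / 2) - 2) / 2) := by
    rw [div_eq_mul_inv (6 * (k p : ℝ)), ← exp_neg]
    gcongr
    · linarith
    · nlinarith
  have hmain' := hmain.trans (mul_le_mul_of_nonneg_left
    (mul_le_mul_of_nonneg_left hexp hlam.le) (Nat.cast_nonneg n))
  have hk0 : (0 : ℝ) < k p := by linarith
  set X := exp (lam * (√((k p : ℝ) / 2) - 2) / 2) with hX
  have hX0 : 0 < X := exp_pos _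
  have e1 : X * (log 2 - binEntropy (2 * θ)) / (6 * lam * k p) * (1 - δ - ε p) =
      (log 2 - binEntropy (2 * θ)) * (1 - δ - ε p) * (X / (6 * lam * k p)) := by ring
  have e2 : (n : ℝ) = n * (lam * (6 * k p / X)) * (X / (6 * lam * k p)) := by field_simp
  exact e1.trans_le ((mul_le_mul_of_nonneg_right hmain' (by positivity)).trans_eq e2.symm)

/-- The second term of the maximum. -/
theorem bounded_degree_bound {c ν θ : ℝ} (hc : 0 < c) (hν0 : 0 ≤ ν) (hν1 : ν < 1)
    (hθ0 : 0 < θ) (hθ1 : θ < 1 / 2) :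
    ∃ ε : ℕ → ℝ, Tendsto ε atTop (𝓝 0) ∧ ∀ᶠ p in atTop,
      ∀ (n : ℕ) (lam δ : ℝ) (est : Estimator n p), 0 < lam →
        worstCaseError est lam (distortionLevel θ (edgeBound c ν p))
          (edgeBoundedClass p (edgeBound c ν p)) ≤ δ →
        (log 2 - binEntropy θ) /
            (lam * ((exp (2 * lam) * cosh (4 * lam * c * (p : ℝ) ^ ν) - 1) /
              (exp (2 * lam) * cosh (4 * lam * c * (p : ℝ) ^ ν) + 1))) * (1 - δ - ε p) ≤ n := by
  set k : ℕ → ℕ := edgeBound c ν with hk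
  -- Degrees up to `m + 1 > 2 c p ^ ν` leave room for nearly all `k` edges, and the `m ≤ 2 c p ^ ν`
  -- other neighbours give exactly the argument of `cosh` in the claim.
  set m : ℕ → ℕ := fun p => ⌊2 * c * (p : ℝ) ^ ν⌋₊ with hm
  set N : ℕ → ℕ := fun p => min (k p) ((m p + 1) * (p / 2)) with hN
  have hkinf : Tendsto (fun p => (k p : ℝ)) atTop atTop := tendsto_edgeBound_atTop hc hν0
  have hNge : ∀ᶠ p in atTop, (k p : ℝ) * (1 - 1 / p) ≤ N p := by
    filter_upwards [eventually_gt_atTop 0] with p hp0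
    have hp0' : (1 : ℝ) ≤ p := by exact_mod_cast hp0
    have hinv : 0 ≤ 1 / (p : ℝ) := by positivity
    have hinv1 : 1 / (p : ℝ) ≤ 1 := by rw [div_le_one (by linarith)]; exact hp0'
    simp only [hN, Nat.cast_min, le_min_iff]
    refine ⟨mul_le_of_le_one_right (Nat.cast_nonneg _) (by linarith), ?_⟩
    have h1 := edgeBound_le hc ν p
    rw [rpow_add (by linarith), rpow_one] at h1
    have h2 : 2 * c * (p : ℝ) ^ ν < m p + 1 := Nat.lt_floor_add_one _
    have h3 : ((p : ℝ) - 1) / 2 ≤ ((p / 2 : ℕ) : ℝ) := by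
      have : p ≤ 2 * (p / 2) + 1 := by omega
      have : (p : ℝ) ≤ 2 * ((p / 2 : ℕ) : ℝ) + 1 := by exact_mod_cast this
      linarith
    calc (k p : ℝ) * (1 - 1 / p) ≤ c * (p * (p : ℝ) ^ ν) * (1 - 1 / p) :=
          mul_le_mul_of_nonneg_right h1 (by linarith)
      _ = (2 * c * (p : ℝ) ^ ν) * ((p - 1) / 2) := by field_simp
      _ ≤ (m p + 1) * ((p / 2 : ℕ) : ℝ) :=
          mul_le_mul h2.le h3 (by linarith) (by positivity)
      _ = (((m p + 1) * (p / 2) : ℕ) : ℝ) := by push_cast; ring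
  have hNk : ∀ p, (N p : ℝ) ≤ k p := fun p => by exact_mod_cast min_le_left _ _
  have hone : Tendsto (fun p : ℕ => 1 - 1 / (p : ℝ)) atTop (𝓝 1) := by
    simpa using (tendsto_const_nhds (x := (1 : ℝ))).sub
      (tendsto_natCast_atTop_atTop (R := ℝ)|>.const_div_atTop 1)
  have hNk1 : Tendsto (fun p => (N p : ℝ) / k p) atTop (𝓝 1) := by
    refine tendsto_of_tendsto_of_tendsto_of_le_of_le' hone tendsto_const_nhds ?_ ?_
    · filter_upwards [hNge, hkinf.eventually_gt_atTop 0] with p hp hk0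
      rw [le_div_iff₀ hk0]; linarith
    · filter_upwards [hkinf.eventually_gt_atTop 0] with p hk0
      rw [div_le_one hk0]; exact hNk p
  have hkN : Tendsto (fun p => (k p : ℝ) / N p) atTop (𝓝 1) := by
    simpa using hNk1.inv₀ one_ne_zero
  have hNinf : Tendsto (fun p => (N p : ℝ)) atTop atTop :=
    tendsto_atTop_mono' _ hNge (hkinf.atTop_mul_pos one_pos hone)
  obtain ⟨ε, hε, hev⟩ := exists_error_term hθ0 one_pos (by linarith) (fun p => (k p : ℝ))
    (fun p => (N p : ℝ)) hNinf hkN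
  rw [one_mul] at hev
  refine ⟨ε, hε, ?_⟩
  filter_upwards [hev, hNinf.eventually_gt_atTop 0, eventually_const_mul_rpow_le hν1 (8 * c),
    eventually_ge_atTop 6] with p ⟨hα0, hα1, hεp⟩ hN0 hcp hp6 n lam δ est hlam herr
  have hp6' : (6 : ℝ) ≤ p := by exact_mod_cast hp6
  have hm_le : (m p : ℝ) ≤ 2 * c * (p : ℝ) ^ ν := Nat.floor_le (by positivity)
  have hmp : m p + 1 ≤ p / 2 := by
    rw [Nat.le_div_iff_mul_le two_pos]
    have : ((m p : ℝ) + 1) * 2 ≤ p := by linarith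
    exact_mod_cast this
  have hb := sampleSize_ge_of_bounded_degree hmp (min_le_right _ _) (by exact_mod_cast hN0)
    (min_le_left _ _) est hlam.le herr hα0 hα1 (by
      rw [mul_assoc, div_mul_cancel₀ _ hN0.ne']
      exact Nat.floor_le (by positivity))
  have hδ : 0 ≤ δ := (worstCaseError_nonneg _ _ _ _).trans herr
  set Q := exp (2 * lam) * cosh (2 * lam * m p) with hQ
  set R := exp (2 * lam) * cosh (4 * lam * c * (p : ℝ) ^ ν) with hR
  have hQ1 : 1 ≤ Q := one_le_mul_of_one_le_of_one_le (one_le_exp (by positivity)) (one_le_cosh _)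
  have hR1 : 1 < R := one_lt_mul_of_lt_of_le (one_lt_exp_iff.2 (by positivity)) (one_le_cosh _)
  have hQR : Q ≤ R := by
    refine mul_le_mul_of_nonneg_left ?_ (exp_pos _).le
    rw [cosh_le_cosh, abs_of_nonneg (by positivity), abs_of_nonneg (by positivity)]
    nlinarith
  have hfrac : (Q - 1) / (Q + 1) ≤ (R - 1) / (R + 1) := by
    rw [div_le_div_iff₀ (by linarith) (by linarith)]
    nlinarith
  have hQf : 0 ≤ (Q - 1) / (Q + 1) := div_nonneg (by linarith) (by linarith)
  have hRf : 0 < (R - 1) / (R + 1) := div_pos (by linarith) (by linarith)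
  have hmain := (hεp δ _ hδ (by positivity) hb).trans (mul_le_mul_of_nonneg_left
    (mul_le_mul_of_nonneg_left hfrac hlam.le) (Nat.cast_nonneg n))
  rw [div_mul_eq_mul_div, div_le_iff₀ (by positivity)]
  exact hmain

theorem theorem2 (c ν θ : ℝ) (hc : 0 < c) (hν0 : 0 ≤ ν) (hν1 : ν < 1)
    (hθ0 : 0 < θ) (hθ1 : θ < 1 / 4) :
    ∃ ε : ℕ → ℝ, Tendsto ε atTop (𝓝 0) ∧
      ∀ (p k q n : ℕ) (lam δ : ℝ) (est : Estimator n p),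
        k = edgeBound c ν p → q = distortionLevel θ k → 0 < lam →
        worstCaseError est lam q (edgeBoundedClass p k) ≤ δ →
        max
          (exp (lam * (√((k : ℝ) / 2) - 2) / 2) * (log 2 - binEntropy (2 * θ)) /
            (6 * lam * (k : ℝ)))
          ((log 2 - binEntropy θ) /
            (lam * ((exp (2 * lam) * cosh (4 * lam * c * (p : ℝ) ^ ν) - 1) /
              (exp (2 * lam) * cosh (4 * lam * c * (p : ℝ) ^ ν) + 1)))) *
          (1 - δ - ε p) ≤ (n : ℝ) := by
  obtain ⟨ε₁, hε₁, h₁⟩ := bipartite_bound hc hν0 hν1 hθ0 hθ1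
  obtain ⟨ε₂, hε₂, h₂⟩ := bounded_degree_bound hc hν0 hν1 hθ0 (by linarith : θ < 1 / 2)
  obtain ⟨p₀, hp₀⟩ := eventually_atTop.1 (h₁.and h₂)
  -- For the finitely many `p < p₀` the error `1` makes the bound nonpositive, as `δ ≥ 0`.
  refine ⟨fun p => if p < p₀ then 1 else max (ε₁ p) (ε₂ p), ?_, ?_⟩
  · have h : Tendsto (fun p => max (ε₁ p) (ε₂ p)) atTop (𝓝 0) := by
      simpa using hε₁.max hε₂
    refine h.congr' ?_
    filter_upwards [eventually_ge_atTop p₀] with p hp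
    rw [if_neg hp.not_gt]
  · rintro p k q n lam δ est rfl rfl hlam herr
    have hδ : 0 ≤ δ := (worstCaseError_nonneg _ _ _ _).trans herr
    have hΔ₁ := log_two_sub_binEntropy_pos (by linarith : 2 * θ < 1 / 2)
    have hΔ₂ := log_two_sub_binEntropy_pos (by linarith : θ < 1 / 2)
    have hR1 : 1 ≤ exp (2 * lam) * cosh (4 * lam * c * (p : ℝ) ^ ν) :=
      one_le_mul_of_one_le_of_one_le (one_le_exp (by positivity)) (one_le_cosh _)
    have hb₁ : 0 ≤ exp (lam * (√((edgeBound c ν p : ℝ) / 2) - 2) / 2) *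
        (log 2 - binEntropy (2 * θ)) / (6 * lam * (edgeBound c ν p : ℝ)) := by positivity
    have hb₂ : 0 ≤ (log 2 - binEntropy θ) /
        (lam * ((exp (2 * lam) * cosh (4 * lam * c * (p : ℝ) ^ ν) - 1) /
          (exp (2 * lam) * cosh (4 * lam * c * (p : ℝ) ^ ν) + 1))) :=
      div_nonneg hΔ₂.le (mul_nonneg hlam.le (div_nonneg (by linarith) (by linarith)))
    beta_reduce
    by_cases hp : p < p₀
    · rw [if_pos hp]
      refine (mul_nonpos_of_nonneg_of_nonpos (le_max_of_le_left hb₁) (by linarith)).trans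
        (Nat.cast_nonneg n)
    · rw [if_neg hp]
      obtain ⟨hp₁, hp₂⟩ := hp₀ p (not_lt.1 hp)
      rcases max_choice (exp (lam * (√((edgeBound c ν p : ℝ) / 2) - 2) / 2) *
        (log 2 - binEntropy (2 * θ)) / (6 * lam * (edgeBound c ν p : ℝ)))
        ((log 2 - binEntropy θ) /
          (lam * ((exp (2 * lam) * cosh (4 * lam * c * (p : ℝ) ^ ν) - 1) /
            (exp (2 * lam) * cosh (4 * lam * c * (p : ℝ) ^ ν) + 1)))) with h | h <;> rw [h]
      · refine (mul_le_mul_of_nonneg_left ?_ hb₁).trans (hp₁ n lam δ est hlam herr)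
        linarith [le_max_left (ε₁ p) (ε₂ p)]
      · refine (mul_le_mul_of_nonneg_left ?_ hb₂).trans (hp₂ n lam δ est hlam herr)
        linarith [le_max_right (ε₁ p) (ε₂ p)]
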